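/- Let $T,d\ge 0$ be integers, $I=\{0,1,\dots,T\}$, and equip $\mathbb R^d$ and $\mathbb R\oplus\mathbb R^d$ with their Euclidean norms, the tensor powers $(\mathbb R\oplus\mathbb R^d)^{\otimes m}$ with the Euclidean (Hilbert–Schmidt) norms, and the space $(I\to\mathbb R^d)$ of paths with the norm $\|x\|_\infty=\max_{t\in I}|x(t)|$ and its Borel $\sigma$-algebra. For a tensor series $\mathbf t=(\mathbf t_m)_{m\ge0}\in\prod_{m\ge0}(\mathbb R\oplus\mathbb R^d)^{\otimes m}$ and $r\in\{1,2\}$ put $\|\mathbf t\|_r=\big(\sum_{m\ge0}\|\mathbf t_m\|^r\big)^{1/r}$ and let $\mathbf T^{(r)}$ be the space of those $\mathbf t$ with $\|\mathbf t\|_r<\infty$ (a Banach space for $r=1$, a Hilbert space for $r=2$). Write $\delta_a\mathbf t=(a^m\mathbf t_m)_{m\ge0}$ for the dilation by $a\in\mathbb R$. The (time-augmented, rank $1$) signature of a path $x$ is $$S(x)=\exp(\Delta_0x)\cdot\exp(\Delta_1x)\cdots\exp(\Delta_Tx),\qquad \Delta_0x=(1,x(0)),\quad \Delta_tx=(1,x(t)-x(t-1))\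 \ (1\le t\le T),$$ where $\exp(v)=(v^{\otimes m}/m!)_{m\ge0}$ and $(\mathbf s\cdot\mathbf t)_m=\sum_{i=0}^m\mathbf s_i\otimes\mathbf t_{m-i}$. Let $p,q\in\{1,2\}$. The robust signature is $$\Phi(x)=\delta_{\exp(-\|S(x)\|_p-\|x\|_\infty)}\,S(x)\in\mathbf T^{(q)},$$ and for Borel probability measures $\mu,\nu$ on $(I\to\mathbb R^d)$ set $$d_0(\mu,\nu)=\Big\|\int\Phi(x)\,\mu(dx)-\int\Phi(x)\,\nu(dx)\Big\|_q .$$ (For $q=2$ this is the maximum mean discrepancy of the kernel $\mathbf k(x,y)=\langle\Phi(x),\Phi(y)\rangle-1$.) Then $\Phi$ is Bochner integrable with respect to every Borel probability measure on $(I\to\mathbb R^d)$, so that $d_0$ is well defined, and for every sequence $(\mu_n)$ and every $\mu$ in $\operatorname{Prob}(I\to\mathbb R^d)$: $\mu_n$ converges weakly to $\mu$ if and only if $\lim_{n\to\infty}d_0(\mu_n,\mu)=0$. -/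

import Mathlib

open Filter Topology MeasureTheory
open scoped ENNReal Nat

noncomputable section

namespace RobustSignature

/-- A path `I → ℝ^d`, `I = {0, …, T}`, with `ℝ^d` Euclidean. The norm that Lean puts on this type is
`‖x‖_∞ = max_t |x t|`, and its topology and σ-algebra are the usual ones of `(ℝ^d)^{T+1}`. -/
abbrev PathSpace (T d : ℕ) : Type := Fin (T + 1) → EuclideanSpace ℝ (Fin d)

/-- Elements of `∏_{m ≥ 0} (ℝ ⊕ ℝ^d)^{⊗ m}`, given by their coordinates in the standard basis
`e_{i₁} ⊗ ⋯ ⊗ e_{i_m}`, that is by one real number for every word in the letters `0, …, d`.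
The letter `0` is the time coordinate. -/
abbrev TensorSeries (d : ℕ) : Type := List (Fin (d + 1)) → ℝ

variable {T d : ℕ}

/-- The tensor `1 = (1, 0, 0, …)`. -/
def tensorOne : TensorSeries d := fun w => if w = [] then 1 else 0

/-- The tensor convolution product: the coordinate of `(s · t)_m = ∑_{i ≤ m} s_i ⊗ t_{m-i}`
at a word `w` of length `m`. -/
def tensorMul (s t : TensorSeries d) : TensorSeries d :=
  fun w => ∑ i ∈ Finset.range (w.length + 1), s (w.take i) * t (w.drop i)

/-- The tensor exponential `(v^{⊗ m} / m!)_{m ≥ 0}`. -/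
def tensorExp (v : Fin (d + 1) → ℝ) : TensorSeries d :=
  fun w => (w.map v).prod / (w.length ! : ℝ)

/-- The dilation `δ_a t = (t_0, a t_1, a² t_2, …)`. -/
def dilate (a : ℝ) (s : TensorSeries d) : TensorSeries d := fun w => a ^ w.length * s w

/-- The time-augmented increments of a path, `Δ_0 x = (1, x 0)` and `Δ_t x = (1, x t - x (t-1))`. -/
def increment (x : PathSpace T d) (t : Fin (T + 1)) : Fin (d + 1) → ℝ :=
  Fin.cons 1 (x t - Fin.cases 0 (fun s : Fin T => x s.castSucc) t : EuclideanSpace ℝ (Fin d))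

/-- The coordinates of the signature `S(x) = exp(Δ_0 x) · exp(Δ_1 x) ⋯ exp(Δ_T x)`. -/
def sigCoeff (x : PathSpace T d) : TensorSeries d :=
  (List.ofFn fun t => tensorExp (increment x t)).foldr tensorMul tensorOne

/-- The space `(ℝ ⊕ ℝ^d)^{⊗ m}` with its Euclidean (Hilbert–Schmidt) norm. -/
abbrev Level (d m : ℕ) : Type := EuclideanSpace ℝ (Fin m → Fin (d + 1))

/-- The component of degree `m` of a tensor series. -/
def level (s : TensorSeries d) (m : ℕ) : Level d m :=
  WithLp.toLp 2 fun w => s (List.ofFn w)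

/-- Tensor series with finite norm `(∑_m ‖t_m‖^p)^{1/p}`. For `p = 1` this is the Banach space
completion of the tensor algebra of `ℝ ⊕ ℝ^d` for the norm `∑_m ‖t_m‖`, for `p = 2` it is the Hilbert
space completion for the inner product `∑_m ⟪s_m, t_m⟫`. -/
abbrev TensorSpace (d : ℕ) (p : ℝ≥0∞) : Type := lp (Level d) p

/-- Factorial decay of the coordinates. -/
def FactorialDecay (s : TensorSeries d) : Prop :=
  ∃ C : ℝ, 0 ≤ C ∧ ∀ w, |s w| ≤ C ^ w.length / (w.length ! : ℝ)

theorem factorialDecay_one : FactorialDecay (tensorOne : TensorSeries d) := by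
  refine ⟨0, le_rfl, fun w => ?_⟩
  rcases w with _ | ⟨a, w⟩ <;> simp [tensorOne]

theorem factorialDecay_exp (v : Fin (d + 1) → ℝ) : FactorialDecay (tensorExp v) := by
  refine ⟨‖v‖, norm_nonneg _, fun w => ?_⟩
  have h : |(w.map v).prod| ≤ ‖v‖ ^ w.length := by
    induction w with
    | nil => simp
    | cons a w ih =>
      rw [List.map_cons, List.prod_cons, abs_mul, List.length_cons, pow_succ']
      exact mul_le_mul (norm_le_pi_norm v a) ih (abs_nonneg _) (norm_nonneg _)
  rw [tensorExp, abs_div, Nat.abs_cast]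
  gcongr

theorem FactorialDecay.mul {s t : TensorSeries d} (hs : FactorialDecay s) (ht : FactorialDecay t) :
    FactorialDecay (tensorMul s t) := by
  obtain ⟨A, hA, hs⟩ := hs
  obtain ⟨B, hB, ht⟩ := ht
  refine ⟨A + B, add_nonneg hA hB, fun w => ?_⟩
  rw [add_pow, Finset.sum_div]
  refine (Finset.abs_sum_le_sum_abs _ _).trans (Finset.sum_le_sum fun i hi => ?_)
  have hi' : i ≤ w.length := Nat.lt_succ_iff.mp (Finset.mem_range.mp hi)
  have h1 := hs (w.take i)
  have h2 := ht (w.drop i)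
  rw [List.length_take, min_eq_left hi'] at h1
  rw [List.length_drop] at h2
  rw [abs_mul]
  refine (mul_le_mul h1 h2 (abs_nonneg _) (by positivity)).trans (le_of_eq ?_)
  rw [Nat.cast_choose ℝ hi']
  field_simp

theorem FactorialDecay.dilate {s : TensorSeries d} (hs : FactorialDecay s) (a : ℝ) :
    FactorialDecay (dilate a s) := by
  obtain ⟨C, hC, hs⟩ := hs
  refine ⟨|a| * C, by positivity, fun w => ?_⟩
  rw [RobustSignature.dilate, abs_mul, abs_pow, mul_pow, mul_div_assoc]
  gcongr
  exact hs w

theorem factorialDecay_sigCoeff (x : PathSpace T d) : FactorialDecay (sigCoeff x) := by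
  have h : ∀ l : List (TensorSeries d), (∀ s ∈ l, FactorialDecay s) →
      FactorialDecay (l.foldr tensorMul tensorOne) := by
    intro l
    induction l with
    | nil => exact fun _ => factorialDecay_one
    | cons s l ih =>
      intro hl
      exact (hl s (by simp)).mul (ih fun t ht => hl t (by simp [ht]))
  refine h _ fun s hs => ?_
  obtain ⟨t, rfl⟩ := (List.mem_ofFn' _ _).mp hs
  exact factorialDecay_exp _

theorem FactorialDecay.memℓp {s : TensorSeries d} (hs : FactorialDecay s) (p : ℝ≥0∞)
    [hp : Fact (1 ≤ p)] : Memℓp (level s) p := by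
  refine Memℓp.of_exponent_ge ?_ hp.out
  obtain ⟨C, hC, hs⟩ := hs
  refine memℓp_gen ?_
  simp only [ENNReal.toReal_one, Real.rpow_one]
  refine Summable.of_nonneg_of_le (fun m => norm_nonneg _) (fun m => ?_)
    (Real.summable_pow_div_factorial (((d : ℝ) + 1) * C))
  have hD : (0 : ℝ) ≤ C ^ m / (m ! : ℝ) := by positivity
  have hd : (1 : ℝ) ≤ ((d : ℝ) + 1) ^ m := one_le_pow₀ (by linarith [Nat.cast_nonneg (α := ℝ) d])
  rw [EuclideanSpace.norm_eq, mul_pow, mul_div_assoc]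
  refine Real.sqrt_le_iff.mpr ⟨by positivity, ?_⟩
  have h : ∀ w : Fin m → Fin (d + 1), ‖level s m w‖ ^ 2 ≤ (C ^ m / (m ! : ℝ)) ^ 2 := by
    intro w
    have := hs (List.ofFn w)
    rw [List.length_ofFn] at this
    exact pow_le_pow_left₀ (norm_nonneg _) this 2
  refine (Finset.sum_le_sum fun w _ => h w).trans ?_
  rw [Finset.sum_const, Finset.card_univ, Fintype.card_fun, Fintype.card_fin, Fintype.card_fin,
    nsmul_eq_mul, mul_pow]
  push_cast
  gcongr
  exact le_self_pow₀ hd two_ne_zero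

/-- The signature `S(x)` as an element of the normed space of tensor series. -/
def sig (p : ℝ≥0∞) [Fact (1 ≤ p)] (x : PathSpace T d) : TensorSpace d p :=
  ⟨level (sigCoeff x), (factorialDecay_sigCoeff x).memℓp p⟩

/-- The scaling `exp(-‖S(x)‖ - ‖x‖_∞)`, with the norm of index `p` of the signature. -/
def scaling (p : ℝ≥0∞) [Fact (1 ≤ p)] (x : PathSpace T d) : ℝ :=
  Real.exp (-‖sig p x‖ - ‖x‖)

/-- The robust signature `δ_{exp(-‖S(x)‖ - ‖x‖_∞)} S(x)`, with the norm of index `p` in the exponent,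
as an element of the space of tensor series with the norm of index `q`. -/
def robustSig (p q : ℝ≥0∞) [Fact (1 ≤ p)] [Fact (1 ≤ q)] (x : PathSpace T d) : TensorSpace d q :=
  ⟨level (dilate (scaling p x) (sigCoeff x)),
    ((factorialDecay_sigCoeff x).dilate (scaling p x)).memℓp q⟩

/-- The robust expected signature `∫ S(x) μ(dx)`, a Bochner integral. -/
def expectedRobustSig (p q : ℝ≥0∞) [Fact (1 ≤ p)] [Fact (1 ≤ q)]
    (μ : ProbabilityMeasure (PathSpace T d)) : TensorSpace d q :=
  ∫ x, robustSig p q x ∂(μ : Measure (PathSpace T d))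

/-- The distance `d_0(μ, ν)`, the norm of the difference of the robust expected signatures. For
`q = 2` it is the maximum mean discrepancy of the kernel `⟪robustSig x, robustSig y⟫ - 1`. -/
def d0 (p q : ℝ≥0∞) [Fact (1 ≤ p)] [Fact (1 ≤ q)] (μ ν : ProbabilityMeasure (PathSpace T d)) : ℝ :=
  ‖expectedRobustSig p q μ - expectedRobustSig p q ν‖

end RobustSignature

end

/-! Write `a` for the scaling and `f_w(x) = a(x)^|w| S(x)_w` for the coordinates of the robust
signature. For `m ≥ 1`, since `‖S‖ ≥ 1`, the level `m` has norm at most `(a ‖S‖)^m`, and `u * exp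
(-u) ≤ exp (-1)` bounds this by `exp(-m) * exp(-‖x‖)`. The geometric factor gives integrability, and
it upgrades convergence of all coordinates to convergence in norm; hence weak convergence implies
`d0 → 0`.

For the converse, the factor `exp(-‖x‖)` makes every `f_w` with `w ≠ []` vanish at infinity, while
`f_[] = 1`. So all `f_w` extend to the one-point compactification of the path space. Products of
exponentials and their dilations satisfy the shuffle identity, so the span of the extended `f_w` is
an algebra. It separates points: the time coordinate is positive on paths and `0` at infinity, it
determines `a`, hence `S`, and `S` determines the path (`sigCoeff_injective`). By Stone–Weierstrass
the span is dense. Convergence in `d0` gives convergence of the integrals of all `f_w`, hence of all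
continuous functions on the compactification. No mass escapes since the limit is a probability
measure, so this is weak convergence (`tendsto_of_forall_onePoint`). -/

noncomputable section

namespace RobustSignature

/-! ### Shuffles of words -/

section Shuffle

variable {α : Type*}

/-- The sum of the values of `g` over the shuffles of two words. -/
def shuffleSum : (List α → ℝ) → List α → List α → ℝ
  | g, [], u => g u
  | g, a :: w, [] => g (a :: w)
  | g, a :: w, b :: u =>
    shuffleSum (fun z => g (a :: z)) w (b :: u) + shuffleSum (fun z => g (b :: z)) (a :: w) u
termination_by _ w u => w.length + u.length

@[simp] theorem shuffleSum_nil_left (g : List α → ℝ) (u : List α) : shuffleSum g [] u = g u := by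
  rw [shuffleSum]

@[simp] theorem shuffleSum_nil_right (g : List α → ℝ) (w : List α) : shuffleSum g w [] = g w := by
  cases w <;> rw [shuffleSum]

theorem shuffleSum_cons_cons (g : List α → ℝ) (a b : α) (w u : List α) :
    shuffleSum g (a :: w) (b :: u) =
      shuffleSum (fun z => g (a :: z)) w (b :: u) +
        shuffleSum (fun z => g (b :: z)) (a :: w) u := by
  rw [shuffleSum]

theorem shuffle_induction {P : List α → List α → Prop} (nil_left : ∀ u, P [] u)
    (nil_right : ∀ w, P w [])
    (cons_cons : ∀ a w b u, P w (b :: u) → P (a :: w) u → P (a :: w) (b :: u)) :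
    ∀ w u, P w u := by
  intro w
  induction w with
  | nil => exact nil_left
  | cons a w ihw =>
    intro u
    induction u with
    | nil => exact nil_right _
    | cons b u ihu => exact cons_cons a w b u (ihw _) ihu

/-- Linearity in the form produced by `tensorMul_cons`. -/
theorem shuffleSum_add_mul (w u : List α) : ∀ (f g : List α → ℝ) (c : ℝ),
    shuffleSum (fun z => f z + c * g z) w u = shuffleSum f w u + c * shuffleSum g w u := by
  induction w, u using shuffle_induction with
  | nil_left u => simp
  | nil_right w => simp
  | cons_cons a w b u h₁ h₂ =>
    intro f g c
    simp only [shuffleSum_cons_cons]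
    rw [h₁ (fun z => f (a :: z)) (fun z => g (a :: z)), h₂ (fun z => f (b :: z)) (fun z => g (b :: z))]
    ring

/-- All shuffles of two words have the same length. The shift `k` records the letters already split
off in the recursion. -/
theorem shuffleSum_pow_mul (a : ℝ) (w u : List α) : ∀ (g : List α → ℝ) (k : ℕ),
    shuffleSum (fun z => a ^ (z.length + k) * g z) w u =
      a ^ (w.length + u.length + k) * shuffleSum g w u := by
  induction w, u using shuffle_induction with
  | nil_left u => simp
  | nil_right w => simp
  | cons_cons b w c u h₁ h₂ =>
    intro g k
    have e₁ := h₁ (fun z => g (b :: z)) (k + 1)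
    have e₂ := h₂ (fun z => g (c :: z)) (k + 1)
    simp only [shuffleSum_cons_cons, List.length_cons] at e₁ e₂ ⊢
    simp only [add_assoc, add_comm 1 k] at e₁ e₂ ⊢
    rw [e₁, e₂]
    ring

/-- The product of the letters and the length are the same for every shuffle, so only the number of
shuffles matters, and it obeys Pascal's rule. A general `h` lets the induction absorb the letter
split off. -/
theorem shuffleSum_prod_mul (v : α → ℝ) (w u : List α) : ∀ h : ℕ → ℝ,
    shuffleSum (fun z => (z.map v).prod * h z.length) w u =
      (w.length + u.length).choose w.length * ((w.map v).prod * (u.map v).prod) *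
        h (w.length + u.length) := by
  induction w, u using shuffle_induction with
  | nil_left u => simp
  | nil_right w => simp
  | cons_cons a w b u h₁ h₂ =>
    intro h
    have e₁ := h₁ (fun n => v a * h (n + 1))
    have e₂ := h₂ (fun n => v b * h (n + 1))
    rw [shuffleSum_cons_cons]
    simp only [List.map_cons, List.prod_cons, List.length_cons] at e₁ e₂ ⊢
    have r (c : α) (z : List α) : v c * (z.map v).prod * h (z.length + 1) =
      (z.map v).prod * (v c * h (z.length + 1)) := by ring
    simp only [r]
    rw [e₁, e₂, show w.length + 1 + (u.length + 1) = (w.length + u.length + 1) + 1 by ring,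
      Nat.choose_succ_succ, show w.length + (u.length + 1) = w.length + u.length + 1 by ring,
      show w.length + 1 + u.length = w.length + u.length + 1 by ring]
    push_cast
    ring

/-- If all the functions `x ↦ g x z` lie in a subspace, so do their sums over shuffles. -/
theorem shuffleSum_mem {X : Type*} (M : Submodule ℝ (X → ℝ)) (w u : List α) :
    ∀ g : X → List α → ℝ, (∀ z, (fun x => g x z) ∈ M) → (fun x => shuffleSum (g x) w u) ∈ M := by
  induction w, u using shuffle_induction with
  | nil_left u => intro g hg; simpa using hg u
  | nil_right w => intro g hg; simpa using hg w
  | cons_cons a w b u h₁ h₂ =>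
    intro g hg
    simp only [shuffleSum_cons_cons]
    exact M.add_mem (h₁ (fun x z => g x (a :: z)) fun z => hg _)
      (h₂ (fun x z => g x (b :: z)) fun z => hg _)

end Shuffle

/-! ### The shuffle identity for signatures -/

variable {T d : ℕ}

theorem tensorMul_cons (s t : TensorSeries d) (a : Fin (d + 1)) (w : List (Fin (d + 1))) :
    tensorMul s t (a :: w) = tensorMul (fun z => s (a :: z)) t w + s [] * t (a :: w) := by
  simp [tensorMul, Finset.sum_range_succ']

/-- Deconcatenation is compatible with shuffles. -/
theorem shuffleSum_tensorMul (w u : List (Fin (d + 1))) : ∀ s t : TensorSeries d,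
    shuffleSum (tensorMul s t) w u =
      ∑ i ∈ Finset.range (w.length + 1), ∑ j ∈ Finset.range (u.length + 1),
        shuffleSum s (w.take i) (u.take j) * shuffleSum t (w.drop i) (u.drop j) := by
  induction w, u using shuffle_induction with
  | nil_left u => intro s t; simp [tensorMul]
  | nil_right w => intro s t; simp [tensorMul]
  | cons_cons a w b u h₁ h₂ =>
    intro s t
    rw [shuffleSum_cons_cons]
    simp only [tensorMul_cons]
    rw [shuffleSum_add_mul w (b :: u) (tensorMul (fun z => s (a :: z)) t) (fun z => t (a :: z)),
      shuffleSum_add_mul (a :: w) u (tensorMul (fun z => s (b :: z)) t) (fun z => t (b :: z)),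
      h₁, h₂]
    simp only [List.length_cons, Finset.sum_range_succ' _ (u.length + 1),
      Finset.sum_range_succ' _ (w.length + 1), List.take_succ_cons, List.drop_succ_cons,
      List.take_zero, List.drop_zero, shuffleSum_cons_cons, shuffleSum_nil_left,
      shuffleSum_nil_right, add_mul, Finset.sum_add_distrib]
    ring

/-- The shuffle identity: `s` is a character of the shuffle algebra. -/
def IsShuffleCharacter (s : TensorSeries d) : Prop :=
  ∀ w u, shuffleSum s w u = s w * s u

theorem IsShuffleCharacter.mul {s t : TensorSeries d} (hs : IsShuffleCharacter s)
    (ht : IsShuffleCharacter t) : IsShuffleCharacter (tensorMul s t) := by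
  intro w u
  rw [shuffleSum_tensorMul, tensorMul, tensorMul, Finset.sum_mul_sum]
  refine Finset.sum_congr rfl fun i _ => Finset.sum_congr rfl fun j _ => ?_
  rw [hs, ht]
  ring

/-- The binomial number of shuffles turns `1 / (m + n)!` into `1 / (m! n!)`. -/
theorem isShuffleCharacter_exp (v : Fin (d + 1) → ℝ) : IsShuffleCharacter (tensorExp v) := by
  intro w u
  have h := shuffleSum_prod_mul v w u fun n => ((n ! : ℝ))⁻¹
  simp only [← div_eq_mul_inv] at h
  refine h.trans ?_
  rw [tensorExp, tensorExp, Nat.cast_add_choose]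
  field_simp

theorem IsShuffleCharacter.dilate {s : TensorSeries d} (hs : IsShuffleCharacter s) (a : ℝ) :
    IsShuffleCharacter (dilate a s) := by
  intro w u
  have h := shuffleSum_pow_mul a w u s 0
  simp only [add_zero] at h
  refine h.trans ?_
  rw [hs, RobustSignature.dilate, RobustSignature.dilate, pow_add]
  ring

theorem tensorOne_eq_exp : (tensorOne : TensorSeries d) = tensorExp 0 := by
  funext w
  cases w <;> simp [tensorOne, tensorExp]

theorem isShuffleCharacter_one : IsShuffleCharacter (tensorOne : TensorSeries d) := by
  rw [tensorOne_eq_exp]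
  exact isShuffleCharacter_exp 0

theorem isShuffleCharacter_sigCoeff (x : PathSpace T d) : IsShuffleCharacter (sigCoeff x) := by
  have h : ∀ l : List (TensorSeries d), (∀ s ∈ l, IsShuffleCharacter s) →
      IsShuffleCharacter (l.foldr tensorMul tensorOne) := by
    intro l
    induction l with
    | nil => exact fun _ => isShuffleCharacter_one
    | cons s l ih =>
      intro hl
      exact (hl s (by simp)).mul (ih fun t ht => hl t (by simp [ht]))
  refine h _ fun s hs => ?_
  obtain ⟨t, rfl⟩ := (List.mem_ofFn' _ _).mp hs
  exact isShuffleCharacter_exp _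

/-! ### The signature determines the path -/

section Injectivity

theorem tensorExp_replicate {v : Fin (d + 1) → ℝ} (hv : v 0 = 1) (k : ℕ) :
    tensorExp v (List.replicate k 0) = 1 / (k ! : ℝ) := by
  simp [tensorExp, hv]

theorem tensorExp_cons_replicate {v : Fin (d + 1) → ℝ} (hv : v 0 = 1) (c : Fin (d + 1)) (k : ℕ) :
    tensorExp v (c :: List.replicate k 0) = v c / ((k + 1) ! : ℝ) := by
  simp [tensorExp, hv]

theorem add_pow_div_factorial (x y : ℝ) (k : ℕ) :
    (x + y) ^ k / (k ! : ℝ) =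
      ∑ j ∈ Finset.range (k + 1), x ^ j / (j ! : ℝ) * (y ^ (k - j) / ((k - j) ! : ℝ)) := by
  rw [add_pow, Finset.sum_div]
  refine Finset.sum_congr rfl fun j hj => ?_
  rw [Nat.cast_choose ℝ (Nat.lt_succ_iff.mp (Finset.mem_range.mp hj))]
  field_simp

/-- Words in the letter `0` see only the time components, each equal to `1`, so the product behaves
like the scalar exponential of `n`. -/
theorem foldr_exp_replicate : ∀ (n : ℕ) (V : Fin n → Fin (d + 1) → ℝ), (∀ t, V t 0 = 1) →
    ∀ k : ℕ, (List.ofFn fun t => tensorExp (V t)).foldr tensorMul tensorOne (List.replicate k 0) =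
      (n : ℝ) ^ k / (k ! : ℝ) := by
  intro n
  induction n with
  | zero => intro V hV k; cases k <;> simp [tensorOne]
  | succ n ih =>
    intro V hV k
    rw [List.ofFn_succ, List.foldr_cons, tensorMul, List.length_replicate]
    push_cast
    rw [add_comm (n : ℝ) 1, add_pow_div_factorial]
    refine Finset.sum_congr rfl fun j hj => ?_
    rw [List.take_replicate, List.drop_replicate, tensorExp_replicate (hV 0),
      ih (fun t => V t.succ) fun t => hV _, one_pow,
      min_eq_left (Nat.lt_succ_iff.mp (Finset.mem_range.mp hj))]

/-- The coordinate of a product of exponentials at `e_c ⊗ e_0 ⊗ ⋯ ⊗ e_0`. -/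
theorem foldr_exp_cons_replicate (c : Fin (d + 1)) (k : ℕ) :
    ∀ (n : ℕ) (V : Fin n → Fin (d + 1) → ℝ), (∀ t, V t 0 = 1) →
    (List.ofFn fun t => tensorExp (V t)).foldr tensorMul tensorOne (c :: List.replicate k 0) =
      ∑ t : Fin n, V t c * ((((n - t : ℕ) : ℝ) ^ (k + 1) - ((n - (t + 1) : ℕ) : ℝ) ^ (k + 1)) /
        ((k + 1) ! : ℝ)) := by
  intro n
  induction n with
  | zero => intro V hV; simp [tensorOne]
  | succ n ih =>
    intro V hV
    rw [List.ofFn_succ, List.foldr_cons, tensorMul_cons, ih (fun t => V t.succ) fun t => hV _,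
      Fin.sum_univ_succ]
    congr 1
    -- The first factor must contain the leading letter `c`; the excluded term `j = 0` of the
    -- binomial expansion is the subtracted power of `n`.
    · have h := add_pow_div_factorial 1 (n : ℝ) (k + 1)
      rw [Finset.sum_range_succ'] at h
      simp only [one_pow, Nat.add_sub_add_right, Nat.factorial_zero, Nat.cast_one, div_one,
        one_mul, Nat.sub_zero] at h
      simp only [Fin.val_zero, Nat.sub_zero, zero_add, Nat.add_sub_cancel]
      push_cast
      rw [add_comm (n : ℝ) 1, sub_div, h, add_sub_cancel_right, Finset.mul_sum, tensorMul,
        List.length_replicate]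
      refine Finset.sum_congr rfl fun j hj => ?_
      rw [List.take_replicate, List.drop_replicate,
        min_eq_left (Nat.lt_succ_iff.mp (Finset.mem_range.mp hj)),
        tensorExp_cons_replicate (hV 0), foldr_exp_replicate n (fun t => V t.succ) fun t => hV _]
      ring
    · simp [tensorExp, Nat.add_sub_add_right]

/-- A vector orthogonal to the differences of all powers over the unit steps vanishes. -/
theorem eq_zero_of_sum_mul_pow_sub_pow {n : ℕ} (f : Fin n → ℝ)
    (h : ∀ k : ℕ, ∑ t, f t * (((n - t : ℕ) : ℝ) ^ (k + 1) - ((n - (t + 1) : ℕ) : ℝ) ^ (k + 1)) = 0)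
    (t : Fin n) : f t = 0 := by
  -- Constants cancel in the differences, so the powers of positive degree suffice for all
  -- polynomials.
  have key : ∀ P : Polynomial ℝ,
      ∑ t, f t * (P.eval ((n - t : ℕ) : ℝ) - P.eval ((n - (t + 1) : ℕ) : ℝ)) = 0 := by
    intro P
    induction P using Polynomial.induction_on' with
    | add P Q hP hQ =>
      rw [← add_zero (0 : ℝ)]
      nth_rewrite 1 [← hP]
      rw [← hQ, ← Finset.sum_add_distrib]
      refine Finset.sum_congr rfl fun t _ => ?_
      simp only [Polynomial.eval_add]
      ring
    | monomial k a =>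
      rcases k with _ | k
      · simp
      · have h' := congrArg (a * ·) (h k)
        simp only [mul_zero, Finset.mul_sum] at h'
        rw [← h']
        refine Finset.sum_congr rfl fun t _ => ?_
        simp only [Polynomial.eval_monomial]
        ring
  -- A step function whose only jump is between `n - (t + 1)` and `n - t`; interpolating it at `0,
  -- …, n` isolates `f t`.
  set r : ℕ → ℝ := fun m => if n - t ≤ m then 1 else 0 with hr
  have hinj : Set.InjOn (fun m : ℕ => (m : ℝ)) (Finset.range (n + 1)) :=
    fun a _ b _ hab => Nat.cast_injective hab
  have hev : ∀ m, m ≤ n →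
      (Lagrange.interpolate (Finset.range (n + 1)) (fun m : ℕ => (m : ℝ)) r).eval (m : ℝ) = r m :=
    fun m hm => Lagrange.eval_interpolate_at_node r hinj (Finset.mem_range.mpr (by omega))
  have hP := key (Lagrange.interpolate (Finset.range (n + 1)) (fun m : ℕ => (m : ℝ)) r)
  rw [Finset.sum_eq_single t] at hP
  · rw [hev _ (by omega), hev _ (by omega)] at hP
    have := t.2
    simp only [hr] at hP
    rwa [if_pos le_rfl, if_neg (by omega), sub_zero, mul_one] at hP
  · intro s _ hs
    rw [hev _ (by omega), hev _ (by omega)]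
    have := t.2
    have := s.2
    have hst : (s : ℕ) ≠ t := fun e => hs (Fin.ext e)
    simp only [hr]
    by_cases hlt : (s : ℕ) < t
    · rw [if_pos (by omega), if_pos (by omega)]; simp
    · rw [if_neg (by omega), if_neg (by omega)]; simp
  · simp

theorem increment_zero (x : PathSpace T d) (t : Fin (T + 1)) : increment x t 0 = 1 := rfl

theorem increment_injective {x y : PathSpace T d} (h : increment x = increment y) : x = y := by
  funext t
  ext i
  have h' := fun t => congrFun (congrFun h t) i.succ
  induction t using Fin.induction with
  | zero => simpa [increment] using h' 0
  | succ t ih =>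
    have := h' t.succ
    simp only [increment, Fin.cons_succ, Fin.cases_succ, PiLp.sub_apply] at this
    linarith

/-- The words `c 0 ⋯ 0` suffice: they test the `c`-components of the increments against differences
of powers of the remaining time. -/
theorem sigCoeff_injective : Function.Injective (sigCoeff : PathSpace T d → TensorSeries d) := by
  intro x y hxy
  refine increment_injective ?_
  funext t c
  rw [← sub_eq_zero]
  refine eq_zero_of_sum_mul_pow_sub_pow (fun t => increment x t c - increment y t c) (fun k => ?_) t
  have h := congrFun hxy (c :: List.replicate k 0)
  rw [sigCoeff, sigCoeff, foldr_exp_cons_replicate c k _ _ (increment_zero x),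
    foldr_exp_cons_replicate c k _ _ (increment_zero y), ← sub_eq_zero, ← Finset.sum_sub_distrib] at h
  have hk : ((k + 1) ! : ℝ) ≠ 0 := by positivity
  have h2 := congrArg (((k + 1) ! : ℝ) * ·) h
  simp only [mul_zero, Finset.mul_sum] at h2
  rw [← h2]
  refine Finset.sum_congr rfl fun t _ => ?_
  field_simp

theorem sigCoeff_nil (x : PathSpace T d) : sigCoeff x [] = 1 := by
  exact (foldr_exp_replicate (T + 1) _ (increment_zero x) 0).trans (by simp)

theorem sigCoeff_time (x : PathSpace T d) : sigCoeff x [0] = T + 1 := by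
  exact (foldr_exp_replicate (T + 1) _ (increment_zero x) 1).trans (by simp)

end Injectivity

/-! ### Norm convergence in `lp` from convergence of the levels -/

section SequenceSpace

variable {E : ℕ → Type*} [∀ m, NormedAddCommGroup (E m)] {q : ℝ≥0∞} [Fact (1 ≤ q)]

theorem lp_norm_le_tsum (hq : q ≠ ⊤) (f : lp E q) (hf : Summable fun m => ‖f m‖) :
    ‖f‖ ≤ ∑' m, ‖f m‖ := by
  have hn : ∀ m, ‖lp.single q m (f m)‖ = ‖f m‖ := fun m =>
    lp.norm_single (zero_lt_one.trans_le Fact.out) m _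
  rw [← (lp.hasSum_single hq f).tsum_eq]
  refine (norm_tsum_le_tsum_norm (by simpa only [hn] using hf)).trans_eq ?_
  simp only [hn, (lp.hasSum_single hq f).tsum_eq]

/-- Dominated convergence for the series of level norms, which bounds the `lp` norm. -/
theorem lp_tendsto_of_dominated {X : Type*} {l : Filter X} (hq : q ≠ ⊤) {F : X → lp E q}
    {f : lp E q} {b : ℕ → ℝ} (hb : Summable b) (hF : ∀ᶠ x in l, ∀ m, ‖F x m - f m‖ ≤ b m)
    (h : ∀ m, Tendsto (fun x => F x m) l (𝓝 (f m))) : Tendsto F l (𝓝 f) := by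
  rw [tendsto_iff_norm_sub_tendsto_zero]
  have h0 : Tendsto (fun x => ∑' m, ‖F x m - f m‖) l (𝓝 (∑' _ : ℕ, (0 : ℝ))) :=
    tendsto_tsum_of_dominated_convergence hb
      (fun m => tendsto_iff_norm_sub_tendsto_zero.mp (h m)) (by simpa using hF)
  rw [tsum_zero] at h0
  refine tendsto_of_tendsto_of_tendsto_of_le_of_le' tendsto_const_nhds h0
    (Eventually.of_forall fun _ => norm_nonneg _) ?_
  filter_upwards [hF] with x hx
  exact lp_norm_le_tsum hq (F x - f) (Summable.of_nonneg_of_le (fun _ => norm_nonneg _) hx hb)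

end SequenceSpace

/-! ### Factorial decay with explicit constants -/

section Decay

theorem abs_tensorExp_le (v : Fin (d + 1) → ℝ) (w : List (Fin (d + 1))) :
    |tensorExp v w| ≤ ‖v‖ ^ w.length / (w.length ! : ℝ) := by
  have h : |(w.map v).prod| ≤ ‖v‖ ^ w.length := by
    induction w with
    | nil => simp
    | cons a w ih =>
      rw [List.map_cons, List.prod_cons, abs_mul, List.length_cons, pow_succ']
      exact mul_le_mul (norm_le_pi_norm v a) ih (abs_nonneg _) (norm_nonneg _)
  rw [tensorExp, abs_div, Nat.abs_cast]
  gcongr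

theorem abs_tensorMul_le {s t : TensorSeries d} {A B : ℝ} (hA : 0 ≤ A)
    (hs : ∀ w, |s w| ≤ A ^ w.length / (w.length ! : ℝ))
    (ht : ∀ w, |t w| ≤ B ^ w.length / (w.length ! : ℝ)) (w : List (Fin (d + 1))) :
    |tensorMul s t w| ≤ (A + B) ^ w.length / (w.length ! : ℝ) := by
  rw [add_pow_div_factorial]
  refine (Finset.abs_sum_le_sum_abs _ _).trans (Finset.sum_le_sum fun i hi => ?_)
  have h1 := hs (w.take i)
  have h2 := ht (w.drop i)
  rw [List.length_take, min_eq_left (Nat.lt_succ_iff.mp (Finset.mem_range.mp hi))] at h1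
  rw [List.length_drop] at h2
  rw [abs_mul]
  exact mul_le_mul h1 h2 (abs_nonneg _) (by positivity)

theorem norm_increment_le (x : PathSpace T d) (t : Fin (T + 1)) :
    ‖increment x t‖ ≤ 1 + 2 * ‖x‖ := by
  have hx := norm_nonneg x
  refine (pi_norm_le_iff_of_nonneg (by positivity)).mpr fun i => ?_
  induction i using Fin.cases with
  | zero => rw [increment_zero, norm_one]; linarith
  | succ i =>
    have h0 : ‖(Fin.cases 0 (fun s : Fin T => x s.castSucc) t : EuclideanSpace ℝ (Fin d))‖ ≤ ‖x‖ := by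
      induction t using Fin.cases with
      | zero => simp
      | succ t => exact norm_le_pi_norm x _
    have h1 := PiLp.norm_apply_le
      (x t - Fin.cases 0 (fun s : Fin T => x s.castSucc) t : EuclideanSpace ℝ (Fin d)) i
    have h2 := norm_sub_le (x t) (Fin.cases 0 (fun s : Fin T => x s.castSucc) t)
    have h3 := norm_le_pi_norm x t
    exact h1.trans (by linarith)

/-- The constants of the factors add up under `tensorMul`. Continuity needs a bound locally uniform
in `x`, which the existential `FactorialDecay` does not provide. -/
theorem abs_sigCoeff_le (x : PathSpace T d) (w : List (Fin (d + 1))) :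
    |sigCoeff x w| ≤ ((T + 1) * (1 + 2 * ‖x‖)) ^ w.length / (w.length ! : ℝ) := by
  have hK : 0 ≤ 1 + 2 * ‖x‖ := by positivity
  have h : ∀ (n : ℕ) (V : Fin n → Fin (d + 1) → ℝ), (∀ t, ‖V t‖ ≤ 1 + 2 * ‖x‖) →
      ∀ w, |(List.ofFn fun t => tensorExp (V t)).foldr tensorMul tensorOne w| ≤
        (n * (1 + 2 * ‖x‖)) ^ w.length / (w.length ! : ℝ) := by
    intro n
    induction n with
    | zero =>
      intro V _ w
      cases w <;> simp [tensorOne]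
    | succ n ih =>
      intro V hV w
      rw [List.ofFn_succ, List.foldr_cons]
      push_cast
      rw [add_comm (n : ℝ) 1, add_mul, one_mul]
      refine abs_tensorMul_le hK (fun w => (abs_tensorExp_le _ w).trans ?_)
        (ih (fun t => V t.succ) fun t => hV _) w
      gcongr
      exact hV 0
  exact (h (T + 1) _ (norm_increment_le x) w).trans_eq (by push_cast; rfl)

/-- There are `(d + 1) ^ m` words of length `m`; the square root of this number is bounded crudely
by the number itself. -/
theorem norm_level_le {s : TensorSeries d} {C : ℝ} (hC : 0 ≤ C)
    (hs : ∀ w, |s w| ≤ C ^ w.length / (w.length ! : ℝ)) (m : ℕ) :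
    ‖level s m‖ ≤ (((d : ℝ) + 1) * C) ^ m / (m ! : ℝ) := by
  have hd : (1 : ℝ) ≤ ((d : ℝ) + 1) ^ m := one_le_pow₀ (by linarith [Nat.cast_nonneg (α := ℝ) d])
  rw [EuclideanSpace.norm_eq, mul_pow, mul_div_assoc]
  refine Real.sqrt_le_iff.mpr ⟨by positivity, ?_⟩
  have h : ∀ w : Fin m → Fin (d + 1), ‖level s m w‖ ^ 2 ≤ (C ^ m / (m ! : ℝ)) ^ 2 := by
    intro w
    have := hs (List.ofFn w)
    rw [List.length_ofFn] at this
    exact pow_le_pow_left₀ (norm_nonneg _) this 2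
  refine (Finset.sum_le_sum fun w _ => h w).trans ?_
  rw [Finset.sum_const, Finset.card_univ, Fintype.card_fun, Fintype.card_fin, Fintype.card_fin,
    nsmul_eq_mul, mul_pow]
  push_cast
  gcongr
  exact le_self_pow₀ hd two_ne_zero

theorem level_dilate (a : ℝ) (s : TensorSeries d) (m : ℕ) :
    level (dilate a s) m = a ^ m • level s m := by
  ext w
  simp [level, dilate]

end Decay

/-! ### Continuity of the robust signature -/

section Continuity

variable {X : Type*} [TopologicalSpace X]

theorem continuous_tensorMul {s t : X → TensorSeries d} (hs : Continuous s) (ht : Continuous t) :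
    Continuous fun x => tensorMul (s x) (t x) :=
  continuous_pi fun _ => continuous_finsetSum _ fun _ _ =>
    ((continuous_apply _).comp hs).mul ((continuous_apply _).comp ht)

theorem continuous_tensorExp {v : X → Fin (d + 1) → ℝ} (hv : Continuous v) :
    Continuous fun x => tensorExp (v x) := by
  refine continuous_pi fun w => Continuous.div_const ?_ _
  induction w with
  | nil => simpa using continuous_const
  | cons a w ih =>
    simp only [List.map_cons, List.prod_cons]
    exact ((continuous_apply a).comp hv).mul ih

theorem continuous_increment (t : Fin (T + 1)) :
    Continuous fun x : PathSpace T d => increment x t := by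
  refine continuous_pi fun i => ?_
  induction i using Fin.cases with
  | zero => exact continuous_const
  | succ i =>
    induction t using Fin.cases with
    | zero => simp only [increment, Fin.cons_succ, Fin.cases_zero, sub_zero]; fun_prop
    | succ t => simp only [increment, Fin.cons_succ, Fin.cases_succ, PiLp.sub_apply]; fun_prop

theorem continuous_sigCoeff : Continuous (sigCoeff : PathSpace T d → TensorSeries d) := by
  have h : ∀ (n : ℕ) (s : Fin n → PathSpace T d → TensorSeries d), (∀ t, Continuous (s t)) →
      Continuous fun x => (List.ofFn fun t => s t x).foldr tensorMul tensorOne := by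
    intro n
    induction n with
    | zero => intro s _; simpa using continuous_const
    | succ n ih =>
      intro s hs
      simp only [List.ofFn_succ, List.foldr_cons]
      exact continuous_tensorMul (hs 0) (ih (fun t => s t.succ) fun t => hs _)
  exact h (T + 1) _ fun t => continuous_tensorExp (continuous_increment t)

theorem continuous_level {s : X → TensorSeries d} (hs : Continuous s) (m : ℕ) :
    Continuous fun x => level (s x) m :=
  (PiLp.continuous_toLp 2 _).comp (continuous_pi fun _ => (continuous_apply _).comp hs)

variable {q : ℝ≥0∞} [Fact (1 ≤ q)]

/-- Coordinatewise continuity and locally uniform factorial decay give continuity in norm. -/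
theorem continuous_tensorSpace_of_decay (hq : q ≠ ⊤) {F : X → TensorSpace d q}
    {s : X → TensorSeries d} (hF : ∀ x m, F x m = level (s x) m) (hs : Continuous s) {C : X → ℝ}
    (hC : Continuous C) (hC0 : ∀ x, 0 ≤ C x)
    (hsC : ∀ x w, |s x w| ≤ C x ^ w.length / (w.length ! : ℝ)) : Continuous F := by
  refine continuous_iff_continuousAt.mpr fun x₀ => ?_
  -- Near `x₀` the constant stays below `C x₀ + 1`; the factor `2` comes from the norm of a
  -- difference.
  have hb := (Real.summable_pow_div_factorial (((d : ℝ) + 1) * (C x₀ + 1))).mul_left 2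
  refine lp_tendsto_of_dominated hq hb ?_ fun m => ?_
  · filter_upwards [hC.continuousAt.eventually (eventually_lt_nhds (lt_add_one (C x₀)))] with x hx m
    have hle : ∀ y, C y ≤ C x₀ + 1 →
        ‖F y m‖ ≤ (((d : ℝ) + 1) * (C x₀ + 1)) ^ m / (m ! : ℝ) := by
      intro y hy
      rw [hF]
      have := hC0 y
      refine (norm_level_le (hC0 y) (hsC y) m).trans ?_
      gcongr
    refine (norm_sub_le _ _).trans ?_
    linarith [hle x hx.le, hle x₀ (by linarith)]
  · simp only [hF]
    exact (continuous_level hs m).continuousAt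

variable {p : ℝ≥0∞} [Fact (1 ≤ p)]

theorem continuous_sig (hp : p ≠ ⊤) : Continuous (sig p : PathSpace T d → TensorSpace d p) :=
  continuous_tensorSpace_of_decay hp (fun _ _ => rfl) continuous_sigCoeff
    (C := fun x => (T + 1) * (1 + 2 * ‖x‖)) (by fun_prop) (fun _ => by positivity) abs_sigCoeff_le

theorem continuous_scaling (hp : p ≠ ⊤) : Continuous (scaling p : PathSpace T d → ℝ) :=
  Real.continuous_exp.comp (((continuous_sig hp).norm.neg).sub continuous_norm)

/-- The coordinates of the robust signature. -/
def robustCoeff (p : ℝ≥0∞) [Fact (1 ≤ p)] (x : PathSpace T d) : TensorSeries d :=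
  dilate (scaling p x) (sigCoeff x)

theorem continuous_robustCoeff (hp : p ≠ ⊤) :
    Continuous (robustCoeff p : PathSpace T d → TensorSeries d) :=
  continuous_pi fun w => ((continuous_scaling hp).pow _).mul
    ((continuous_apply w).comp continuous_sigCoeff)

theorem scaling_pos (x : PathSpace T d) : 0 < scaling p x := Real.exp_pos _

theorem scaling_le_one (x : PathSpace T d) : scaling p x ≤ 1 := by
  rw [scaling, Real.exp_le_one_iff]
  linarith [norm_nonneg (sig p x), norm_nonneg x]

theorem continuous_robustSig (hp : p ≠ ⊤) (hq : q ≠ ⊤) :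
    Continuous (robustSig p q : PathSpace T d → TensorSpace d q) := by
  refine continuous_tensorSpace_of_decay hq (s := robustCoeff p) (fun _ _ => rfl)
    (continuous_robustCoeff hp) (C := fun x => (T + 1) * (1 + 2 * ‖x‖)) (by fun_prop)
    (fun _ => by positivity) fun x w => ?_
  refine le_trans ?_ (abs_sigCoeff_le x w)
  rw [robustCoeff, dilate, abs_mul, abs_pow, abs_of_pos (scaling_pos x)]
  exact mul_le_of_le_one_left (abs_nonneg _) (pow_le_one₀ (scaling_pos x).le (scaling_le_one x))

end Continuity

/-! ### Geometric bounds and decay at infinity -/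

section Bounds

variable {p q : ℝ≥0∞} [Fact (1 ≤ p)] [Fact (1 ≤ q)]

theorem norm_level_sigCoeff_le (x : PathSpace T d) (m : ℕ) : ‖level (sigCoeff x) m‖ ≤ ‖sig p x‖ :=
  lp.norm_apply_le_norm (zero_lt_one.trans_le Fact.out).ne' (sig p x) m

theorem one_le_norm_sig (x : PathSpace T d) : 1 ≤ ‖sig p x‖ := by
  refine le_trans ?_ (norm_level_sigCoeff_le x 0)
  rw [EuclideanSpace.norm_eq]
  simp [level, sigCoeff_nil]

/-- As `‖S‖ ≥ 1` and `m ≥ 1`, the level norm is at most `‖S‖ ^ m`, which the `m`-th power of the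
scaling compensates. Level `0` is excluded, being constantly `1`. -/
theorem norm_level_robustCoeff_le (x : PathSpace T d) {m : ℕ} (hm : m ≠ 0) :
    ‖level (robustCoeff p x) m‖ ≤ Real.exp (-1) ^ m * Real.exp (-‖x‖) := by
  have hs := one_le_norm_sig (p := p) x
  have ha := scaling_pos (p := p) x
  rw [robustCoeff, level_dilate, norm_smul, norm_pow, Real.norm_of_nonneg ha.le]
  have h1 : ‖level (sigCoeff x) m‖ ≤ ‖sig p x‖ ^ m :=
    (norm_level_sigCoeff_le x m).trans (le_self_pow₀ hs hm)
  have h2 : scaling p x * ‖sig p x‖ ≤ Real.exp (-1) * Real.exp (-‖x‖) := by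
    -- This is `u ≤ exp (u - 1)`, that is `u * exp (-u) ≤ exp (-1)`.
    have h := Real.add_one_le_exp (‖sig p x‖ - 1)
    rw [sub_add_cancel] at h
    refine (mul_le_mul_of_nonneg_left h ha.le).trans_eq ?_
    rw [scaling, ← Real.exp_add, ← Real.exp_add]
    ring_nf
  calc scaling p x ^ m * ‖level (sigCoeff x) m‖ ≤ scaling p x ^ m * ‖sig p x‖ ^ m := by gcongr
    _ = (scaling p x * ‖sig p x‖) ^ m := (mul_pow _ _ _).symm
    _ ≤ (Real.exp (-1) * Real.exp (-‖x‖)) ^ m := by gcongr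
    _ = Real.exp (-1) ^ m * Real.exp (-‖x‖) ^ m := mul_pow _ _ _
    _ ≤ _ := by
      gcongr
      exact pow_le_of_le_one (Real.exp_pos _).le
        (Real.exp_le_one_iff.mpr (neg_nonpos.mpr (norm_nonneg x))) hm

theorem norm_level_robustCoeff_le_pow (x : PathSpace T d) (m : ℕ) :
    ‖level (robustCoeff p x) m‖ ≤ Real.exp (-1) ^ m := by
  rcases eq_or_ne m 0 with rfl | hm
  · rw [EuclideanSpace.norm_eq]
    simp [level, robustCoeff, dilate, sigCoeff_nil]
  · exact (norm_level_robustCoeff_le x hm).trans (mul_le_of_le_one_right (by positivity)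
      (Real.exp_le_one_iff.mpr (neg_nonpos.mpr (norm_nonneg x))))

theorem summable_exp_neg_one_pow : Summable fun m : ℕ => Real.exp (-1) ^ m :=
  summable_geometric_of_lt_one (Real.exp_pos _).le (Real.exp_lt_one_iff.mpr (by norm_num))

theorem norm_robustSig_le (hq : q ≠ ⊤) (x : PathSpace T d) :
    ‖robustSig p q x‖ ≤ ∑' m : ℕ, Real.exp (-1) ^ m := by
  have h := norm_level_robustCoeff_le_pow (p := p) x
  have hs := Summable.of_nonneg_of_le (fun _ => norm_nonneg _) h summable_exp_neg_one_pow
  exact (lp_norm_le_tsum hq (robustSig p q x) hs).trans (hs.tsum_le_tsum h summable_exp_neg_one_pow)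

theorem abs_robustCoeff_le_norm_level (x : PathSpace T d) (w : List (Fin (d + 1))) :
    |robustCoeff p x w| ≤ ‖level (robustCoeff p x) w.length‖ := by
  have h := PiLp.norm_apply_le (level (robustCoeff p x) w.length) w.get
  simpa [level] using h

end Bounds

/-! ### Expected robust signatures and their coordinates -/

section Expectation

variable {p q : ℝ≥0∞} [Fact (1 ≤ p)] [Fact (1 ≤ q)]

theorem integrable_robustSig (hp : p ≠ ⊤) (hq : q ≠ ⊤) (ν : ProbabilityMeasure (PathSpace T d)) :
    Integrable (robustSig p q) (ν : Measure (PathSpace T d)) :=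
  Integrable.of_bound (continuous_robustSig hp hq).aestronglyMeasurable _
    (Eventually.of_forall (norm_robustSig_le hq))

/-- The coordinate of a tensor series at a word, as a continuous linear functional. -/
def coordCLM (q : ℝ≥0∞) [Fact (1 ≤ q)] (m : ℕ) (w : Fin m → Fin (d + 1)) :
    TensorSpace d q →L[ℝ] ℝ :=
  (EuclideanSpace.proj w).comp (lp.evalCLM ℝ (Level d) q m)

theorem expectedRobustSig_apply (hp : p ≠ ⊤) (hq : q ≠ ⊤) (ν : ProbabilityMeasure (PathSpace T d))
    (m : ℕ) (w : Fin m → Fin (d + 1)) :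
    expectedRobustSig p q ν m w =
      ∫ x, robustCoeff p x (List.ofFn w) ∂(ν : Measure (PathSpace T d)) :=
  ((coordCLM q m w).integral_comp_comm (integrable_robustSig hp hq ν)).symm

theorem expectedRobustSig_level (hp : p ≠ ⊤) (hq : q ≠ ⊤) (ν : ProbabilityMeasure (PathSpace T d))
    (m : ℕ) : expectedRobustSig p q ν m =
      ∫ x, level (robustCoeff p x) m ∂(ν : Measure (PathSpace T d)) :=
  ((lp.evalCLM ℝ (Level d) q m).integral_comp_comm (integrable_robustSig hp hq ν)).symm

theorem norm_expectedRobustSig_level_le (hp : p ≠ ⊤) (hq : q ≠ ⊤)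
    (ν : ProbabilityMeasure (PathSpace T d)) (m : ℕ) :
    ‖expectedRobustSig p q ν m‖ ≤ Real.exp (-1) ^ m := by
  rw [expectedRobustSig_level hp hq]
  refine (norm_integral_le_of_norm_le_const
    (Eventually.of_forall fun x => norm_level_robustCoeff_le_pow x m)).trans_eq ?_
  simp

/-- Each coordinate is a bounded continuous test function, and the bound `exp (-1) ^ m` on the
levels is the same for all measures. -/
theorem tendsto_expectedRobustSig (hp : p ≠ ⊤) (hq : q ≠ ⊤)
    {μs : ℕ → ProbabilityMeasure (PathSpace T d)} {μ : ProbabilityMeasure (PathSpace T d)}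
    (h : Tendsto μs atTop (𝓝 μ)) :
    Tendsto (fun n => expectedRobustSig p q (μs n)) atTop (𝓝 (expectedRobustSig p q μ)) := by
  refine lp_tendsto_of_dominated hq (summable_exp_neg_one_pow.mul_left 2)
    (Eventually.of_forall fun n m => ?_) fun m => ?_
  · refine (norm_sub_le _ _).trans ?_
    linarith [norm_expectedRobustSig_level_le hp hq (μs n) m,
      norm_expectedRobustSig_level_le hp hq μ m]
  · rw [(PiLp.homeomorph 2 _).isInducing.tendsto_nhds_iff, tendsto_pi_nhds]
    intro w
    have hw := (ProbabilityMeasure.tendsto_iff_forall_integral_tendsto.mp h)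
      (BoundedContinuousFunction.ofNormedAddCommGroup (fun x => robustCoeff p x (List.ofFn w))
        ((continuous_apply _).comp (continuous_robustCoeff hp)) _ fun x =>
          (abs_robustCoeff_le_norm_level x _).trans (norm_level_robustCoeff_le_pow x _))
    exact (hw.congr fun n => (expectedRobustSig_apply hp hq (μs n) m w).symm).mono_right
      (le_of_eq (congrArg 𝓝 (expectedRobustSig_apply hp hq μ m w).symm))

theorem tendsto_integral_robustCoeff (hp : p ≠ ⊤) (hq : q ≠ ⊤)
    {μs : ℕ → ProbabilityMeasure (PathSpace T d)} {μ : ProbabilityMeasure (PathSpace T d)}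
    (h : Tendsto (fun n => expectedRobustSig p q (μs n)) atTop (𝓝 (expectedRobustSig p q μ)))
    (w : List (Fin (d + 1))) :
    Tendsto (fun n => ∫ x, robustCoeff p x w ∂(μs n : Measure (PathSpace T d))) atTop
      (𝓝 (∫ x, robustCoeff p x w ∂(μ : Measure (PathSpace T d)))) := by
  have hw := ((coordCLM q w.length w.get).continuous.tendsto _).comp h
  have e : ∀ ν : ProbabilityMeasure (PathSpace T d),
      coordCLM q w.length w.get (expectedRobustSig p q ν) =
        ∫ x, robustCoeff p x w ∂(ν : Measure (PathSpace T d)) := fun ν =>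
    (expectedRobustSig_apply hp hq ν _ _).trans (by rw [List.ofFn_get])
  simpa only [Function.comp_def, e] using hw

end Expectation

/-! ### Weak convergence via the one-point compactification -/

section WeakConvergence

variable {X : Type*} [NormedAddCommGroup X]

/-- A piecewise linear cutoff, positive on the open ball of radius `n + 1` and zero elsewhere. -/
def cutoff (X : Type*) [NormedAddCommGroup X] (n : ℕ) (x : X) : ℝ :=
  max 0 (1 - ‖x‖ / ((n : ℝ) + 1))

theorem continuous_cutoff (n : ℕ) : Continuous (cutoff X n) := by
  unfold cutoff
  fun_prop

theorem cutoff_nonneg (n : ℕ) (x : X) : 0 ≤ cutoff X n x := le_max_left _ _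

theorem cutoff_le_one (n : ℕ) (x : X) : cutoff X n x ≤ 1 :=
  max_le zero_le_one (sub_le_self _ (by positivity))

theorem tendsto_cutoff (x : X) : Tendsto (fun n => cutoff X n x) atTop (𝓝 1) := by
  have h : Tendsto (fun n : ℕ => 1 - ‖x‖ / ((n : ℝ) + 1)) atTop (𝓝 (1 - 0)) :=
    tendsto_const_nhds.sub
      (tendsto_const_nhds.div_atTop (tendsto_natCast_atTop_atTop.atTop_add tendsto_const_nhds))
  simpa [cutoff] using (tendsto_const_nhds (x := (0 : ℝ))).max h

theorem eventually_cutoff_eq_zero [ProperSpace X] (n : ℕ) : ∀ᶠ x in cocompact X, cutoff X n x = 0 := by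
  filter_upwards [(tendsto_norm_cocompact_atTop (E := X)).eventually_ge_atTop ((n : ℝ) + 1)] with x hx
  refine max_eq_left (sub_nonpos.mpr ?_)
  rwa [le_div_iff₀ (by positivity), one_mul]

variable [MeasurableSpace X] [BorelSpace X]

theorem tendsto_integral_cutoff (μ : Measure X) [IsProbabilityMeasure μ] :
    Tendsto (fun n => ∫ x, cutoff X n x ∂μ) atTop (𝓝 1) := by
  have h := tendsto_integral_of_dominated_convergence (μ := μ) (F := cutoff X) (f := fun _ => 1)
    (fun _ => 1) (fun n => (continuous_cutoff n).measurable.aestronglyMeasurable)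
    (integrable_const 1)
    (fun n => Eventually.of_forall fun x => by
      rw [Real.norm_of_nonneg (cutoff_nonneg n x)]; exact cutoff_le_one n x)
    (Eventually.of_forall tendsto_cutoff)
  simpa using h

/-- Convergence of the integrals of all functions which extend continuously to the one-point
compactification implies weak convergence to a probability measure. -/
theorem tendsto_of_forall_onePoint [ProperSpace X] {μs : ℕ → ProbabilityMeasure X}
    {μ : ProbabilityMeasure X}
    (h : ∀ F : C(OnePoint X, ℝ), Tendsto (fun n => ∫ x, F (x : OnePoint X) ∂(μs n : Measure X)) atTop
      (𝓝 (∫ x, F (x : OnePoint X) ∂(μ : Measure X)))) :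
    Tendsto μs atTop (𝓝 μ) := by
  have hc : ∀ g : X → ℝ, Continuous g → (∀ᶠ x in cocompact X, g x = 0) →
      Tendsto (fun n => ∫ x, g x ∂(μs n : Measure X)) atTop (𝓝 (∫ x, g x ∂(μ : Measure X))) :=
    fun g hg h0 => h (OnePoint.continuousMapMk ⟨g, hg⟩ 0 (by
      rw [coclosedCompact_eq_cocompact]
      exact tendsto_const_nhds.congr' (h0.mono fun _ hx => hx.symm)))
  rw [ProbabilityMeasure.tendsto_iff_forall_integral_tendsto]
  intro f
  rw [Metric.tendsto_atTop]
  intro ε hε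
  -- The final error is `ε / 2` from cutting off under `μs n`, `ε / 4` from cutting off under `μ`,
  -- and `ε / 4` from `h₂`; the `+ 1` covers `f = 0`.
  have hδ : 0 < ε / (4 * (‖f‖ + 1)) := by positivity
  obtain ⟨k, hk⟩ := ((tendsto_integral_cutoff (μ : Measure X)).eventually
    (lt_mem_nhds (sub_lt_self 1 hδ))).exists
  have h₁ := Metric.tendsto_atTop.mp (hc (cutoff X k) (continuous_cutoff k)
    (eventually_cutoff_eq_zero k)) _ hδ
  have h₂ := Metric.tendsto_atTop.mp (hc (fun x => f x * cutoff X k x)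
    (f.continuous.mul (continuous_cutoff k))
    ((eventually_cutoff_eq_zero k).mono fun x hx => by rw [hx, mul_zero])) (ε / 4) (by positivity)
  have est : ∀ ν : ProbabilityMeasure X,
      |∫ x, f x ∂(ν : Measure X) - ∫ x, f x * cutoff X k x ∂(ν : Measure X)| ≤
        (‖f‖ + 1) * (1 - ∫ x, cutoff X k x ∂(ν : Measure X)) := by
    intro ν
    have ic : Integrable (cutoff X k) (ν : Measure X) :=
      Integrable.of_bound (continuous_cutoff k).measurable.aestronglyMeasurable 1
        (Eventually.of_forall fun x => by
          rw [Real.norm_of_nonneg (cutoff_nonneg k x)]; exact cutoff_le_one k x)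
    have i_f : Integrable f (ν : Measure X) := f.integrable _
    have ifc : Integrable (fun x => f x * cutoff X k x) (ν : Measure X) :=
      i_f.mul_bdd (c := 1) ic.aestronglyMeasurable (Eventually.of_forall fun x => by
        rw [Real.norm_of_nonneg (cutoff_nonneg k x)]; exact cutoff_le_one k x)
    rw [← integral_sub i_f ifc, ← Real.norm_eq_abs]
    have e : (‖f‖ + 1) * (1 - ∫ x, cutoff X k x ∂(ν : Measure X)) =
        ∫ x, (‖f‖ + 1) * (1 - cutoff X k x) ∂(ν : Measure X) := by
      rw [integral_const_mul, integral_sub (integrable_const _) ic]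
      simp
    rw [e]
    refine norm_integral_le_of_norm_le (((integrable_const _).sub ic).const_mul _)
      (Eventually.of_forall fun x => ?_)
    rw [← mul_one_sub, norm_mul, Real.norm_of_nonneg (sub_nonneg.mpr (cutoff_le_one k x))]
    have := f.norm_coe_le_norm x
    have := cutoff_le_one k x
    gcongr
    linarith
  obtain ⟨N₁, h₁⟩ := h₁
  obtain ⟨N₂, h₂⟩ := h₂
  refine ⟨max N₁ N₂, fun n hn => ?_⟩
  have a₁ := h₁ n ((le_max_left _ _).trans hn)
  have a₂ := h₂ n ((le_max_right _ _).trans hn)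
  rw [Real.dist_eq] at a₁ a₂ ⊢
  have b₁ := est (μs n)
  have b₂ := est μ
  have hf : (‖f‖ + 1) * (ε / (4 * (‖f‖ + 1))) = ε / 4 := by
    field_simp
  -- Tightness is not assumed: the cutoff is itself a test function, so `μs n` inherits from `μ`
  -- that little mass is cut off.
  have c₁ : (‖f‖ + 1) * (1 - ∫ x, cutoff X k x ∂(μs n : Measure X)) ≤ ε / 4 + ε / 4 := by
    rw [← hf, ← mul_add]
    gcongr
    linarith [(abs_lt.mp a₁).1]
  have c₂ : (‖f‖ + 1) * (1 - ∫ x, cutoff X k x ∂(μ : Measure X)) < ε / 4 := by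
    rw [← hf]
    gcongr
    linarith
  rw [abs_lt] at a₂ ⊢
  rw [abs_le] at b₁ b₂
  constructor <;> linarith [b₁.1, b₁.2, b₂.1, b₂.2, a₂.1, a₂.2]

theorem integrable_onePoint (G : C(OnePoint X, ℝ)) (ν : Measure X) [IsFiniteMeasure ν] :
    Integrable (fun x : X => G x) ν :=
  Integrable.of_bound
    (G.continuous.comp OnePoint.continuous_coe).measurable.aestronglyMeasurable ‖G‖
    (Eventually.of_forall fun x => G.norm_coe_le_norm x)

/-- Convergence of the integrals of a dense set of continuous functions on the one-point
compactification implies that of all of them. -/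
theorem tendsto_integral_onePoint_of_dense {μs : ℕ → ProbabilityMeasure X}
    {μ : ProbabilityMeasure X} {A : Set C(OnePoint X, ℝ)} (hA : Dense A)
    (h : ∀ F ∈ A, Tendsto (fun n => ∫ x, F (x : OnePoint X) ∂(μs n : Measure X)) atTop
      (𝓝 (∫ x, F (x : OnePoint X) ∂(μ : Measure X)))) (F : C(OnePoint X, ℝ)) :
    Tendsto (fun n => ∫ x, F (x : OnePoint X) ∂(μs n : Measure X)) atTop
      (𝓝 (∫ x, F (x : OnePoint X) ∂(μ : Measure X))) := by
  have est : ∀ (G : C(OnePoint X, ℝ)) (ν : ProbabilityMeasure X),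
      |∫ x, F (x : OnePoint X) ∂(ν : Measure X) - ∫ x, G (x : OnePoint X) ∂(ν : Measure X)| ≤
        dist F G := by
    intro G ν
    rw [← integral_sub (integrable_onePoint F _) (integrable_onePoint G _), ← Real.norm_eq_abs]
    refine (norm_integral_le_of_norm_le_const (C := dist F G)
      (Eventually.of_forall fun x => ?_)).trans_eq (by simp)
    rw [← dist_eq_norm]
    exact ContinuousMap.dist_apply_le_dist _
  rw [Metric.tendsto_atTop]
  intro ε hε
  obtain ⟨G, hG, hd⟩ := hA.exists_dist_lt F (show 0 < ε / 3 by positivity)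
  obtain ⟨N, hN⟩ := Metric.tendsto_atTop.mp (h G hG) (ε / 3) (by positivity)
  refine ⟨N, fun n hn => ?_⟩
  have a := hN n hn
  have b₁ := est G (μs n)
  have b₂ := est G μ
  rw [Real.dist_eq, abs_lt] at *
  rw [abs_le] at b₁ b₂
  constructor <;> linarith [b₁.1, b₁.2, b₂.1, b₂.2, a.1, a.2]

end WeakConvergence

/-! ### The algebra of coordinates and Stone–Weierstrass -/

section StoneWeierstrass

variable {p q : ℝ≥0∞} [Fact (1 ≤ p)] [Fact (1 ≤ q)]

/-- Here the term `-‖x‖` of the scaling exponent is used: it gives decay like `exp (-‖x‖)` for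
nonempty words. -/
theorem tendsto_robustCoeff_cocompact (w : List (Fin (d + 1))) :
    Tendsto (fun x : PathSpace T d => robustCoeff p x w) (cocompact _) (𝓝 (tensorOne w)) := by
  rcases eq_or_ne w [] with rfl | hw
  · simp only [robustCoeff, dilate, sigCoeff_nil]
    simpa [tensorOne] using tendsto_const_nhds
  · rw [tensorOne, if_neg hw]
    have h := Real.tendsto_exp_neg_atTop_nhds_zero.comp
      (tendsto_norm_cocompact_atTop (E := PathSpace T d))
    refine squeeze_zero_norm (fun x => ?_) h
    refine (abs_robustCoeff_le_norm_level x w).trans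
      ((norm_level_robustCoeff_le x (by simpa using hw)).trans ?_)
    exact mul_le_of_le_one_left (Real.exp_pos _).le
      (pow_le_one₀ (Real.exp_pos _).le (Real.exp_le_one_iff.mpr (by norm_num)))

/-- The coordinates of the robust signature extend to the one-point compactification, with the
value `1 = (1, 0, 0, …)` at infinity. -/
def robustCoeffOnePoint (T : ℕ) (hp : p ≠ ⊤) (w : List (Fin (d + 1))) :
    C(OnePoint (PathSpace T d), ℝ) :=
  OnePoint.continuousMapMk
    ⟨fun x => robustCoeff p x w, (continuous_apply w).comp (continuous_robustCoeff hp)⟩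
    (tensorOne w) (by
      rw [coclosedCompact_eq_cocompact]
      exact tendsto_robustCoeff_cocompact w)

/-- The value at infinity is the exponential of `0`, so the shuffle identity persists there. -/
theorem isShuffleCharacter_robustCoeffOnePoint (hp : p ≠ ⊤) (x : OnePoint (PathSpace T d)) :
    IsShuffleCharacter (fun w => robustCoeffOnePoint T hp w x) := by
  induction x using OnePoint.rec with
  | infty => exact isShuffleCharacter_one
  | coe x => exact (isShuffleCharacter_sigCoeff x).dilate _

/-- The time coordinate equals `T + 1` times the scaling, so it reveals the scaling, and the
dilation can be undone. -/
theorem robustCoeff_injective :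
    Function.Injective (robustCoeff p : PathSpace T d → TensorSeries d) := by
  intro x y hxy
  have h0 := congrFun hxy [0]
  simp only [robustCoeff, dilate, sigCoeff_time, List.length_singleton, pow_one] at h0
  have hT : (T : ℝ) + 1 ≠ 0 := by positivity
  have ha := mul_right_cancel₀ hT h0
  refine sigCoeff_injective (funext fun w => ?_)
  have h := congrFun hxy w
  simp only [robustCoeff, dilate, ha] at h
  exact mul_left_cancel₀ (pow_ne_zero _ (scaling_pos y).ne') h

/-- The span of the coordinates of the robust signature is an algebra, by the shuffle identity. -/
def robustAlgebra (T d : ℕ) (hp : p ≠ ⊤) : Subalgebra ℝ C(OnePoint (PathSpace T d), ℝ) :=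
  (Submodule.span ℝ (Set.range (robustCoeffOnePoint (d := d) T hp))).toSubalgebra
    (Submodule.subset_span ⟨[], by
      ext x
      induction x using OnePoint.rec with
      | infty => rfl
      | coe x =>
        change robustCoeff p x [] = 1
        simp [robustCoeff, dilate, sigCoeff_nil]⟩)
    (fun f g hf hg => by
      have hm := Submodule.mul_mem_mul hf hg
      rw [Submodule.span_mul_span] at hm
      refine Submodule.span_le.mpr ?_ hm
      rintro _ ⟨_, ⟨w, rfl⟩, _, ⟨u, rfl⟩, rfl⟩
      -- The pointwise product of two coordinates is a shuffle sum of coordinates, hence in their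
      -- span.
      obtain ⟨F, hF, e⟩ := shuffleSum_mem
        ((Submodule.span ℝ (Set.range (robustCoeffOnePoint (d := d) T hp))).map
          (ContinuousMap.coeFnLinearMap ℝ)) w u
        (fun x z => robustCoeffOnePoint T hp z x)
        fun z => ⟨_, Submodule.subset_span ⟨z, rfl⟩, rfl⟩
      convert hF
      ext x
      exact (isShuffleCharacter_robustCoeffOnePoint hp x w u).symm.trans (congrFun e x).symm)

theorem robustAlgebra_separatesPoints (hp : p ≠ ⊤) :
    (robustAlgebra T d hp).SeparatesPoints := by
  intro x y hxy
  by_contra hcon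
  have h : ∀ w, robustCoeffOnePoint T hp w x = robustCoeffOnePoint T hp w y := by
    intro w
    by_contra hne
    exact hcon ⟨_, ⟨robustCoeffOnePoint T hp w, Submodule.subset_span ⟨w, rfl⟩, rfl⟩, hne⟩
  -- The time coordinate separates every path from infinity.
  have hpos : ∀ z : PathSpace T d, (tensorOne : TensorSeries d) [0] ≠ robustCoeff p z [0] := by
    intro z
    have := scaling_pos (p := p) z
    simp only [tensorOne, robustCoeff, dilate, sigCoeff_time, List.length_singleton, pow_one]
    have : 0 < scaling p z * ((T : ℝ) + 1) := by positivity
    simpa using this.ne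
  induction x using OnePoint.rec with
  | infty =>
    induction y using OnePoint.rec with
    | infty => exact hxy rfl
    | coe y => exact hpos y (h [0])
  | coe x =>
    induction y using OnePoint.rec with
    | infty => exact hpos x (h [0]).symm
    | coe y => exact hxy (congrArg _ (robustCoeff_injective (funext h)))

theorem tendsto_of_tendsto_integral_robustCoeff (hp : p ≠ ⊤)
    {μs : ℕ → ProbabilityMeasure (PathSpace T d)} {μ : ProbabilityMeasure (PathSpace T d)}
    (h : ∀ w, Tendsto (fun n => ∫ x, robustCoeff p x w ∂(μs n : Measure (PathSpace T d))) atTop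
      (𝓝 (∫ x, robustCoeff p x w ∂(μ : Measure (PathSpace T d))))) :
    Tendsto μs atTop (𝓝 μ) := by
  have hd : Dense (robustAlgebra T d hp : Set C(OnePoint (PathSpace T d), ℝ)) := by
    rw [dense_iff_closure_eq, ← Subalgebra.topologicalClosure_coe,
      ContinuousMap.subalgebra_topologicalClosure_eq_top_of_separatesPoints _
        (robustAlgebra_separatesPoints hp)]
    rfl
  refine tendsto_of_forall_onePoint (tendsto_integral_onePoint_of_dense hd fun F hF => ?_)
  induction hF using Submodule.span_induction with
  | mem F hF =>
    obtain ⟨w, rfl⟩ := hF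
    exact h w
  | zero => simp
  | add F G _ _ hF hG =>
    simp only [ContinuousMap.add_apply, integral_add (integrable_onePoint F _) (integrable_onePoint G _)]
    exact hF.add hG
  | smul c F _ hF =>
    simp only [ContinuousMap.smul_apply, smul_eq_mul, integral_const_mul]
    exact hF.const_mul c

end StoneWeierstrass

end RobustSignature

end

theorem proposition4p9 (T d : ℕ) (p q : ℝ≥0∞) [Fact (1 ≤ p)] [Fact (1 ≤ q)]
    (hp : p = 1 ∨ p = 2) (hq : q = 1 ∨ q = 2) :
    (∀ ν : ProbabilityMeasure (RobustSignature.PathSpace T d),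
      Integrable (RobustSignature.robustSig p q) (ν : Measure (RobustSignature.PathSpace T d))) ∧
    ∀ (μs : ℕ → ProbabilityMeasure (RobustSignature.PathSpace T d))
      (μ : ProbabilityMeasure (RobustSignature.PathSpace T d)),
      Tendsto μs atTop (𝓝 μ) ↔
        Tendsto (fun n => RobustSignature.d0 p q (μs n) μ) atTop (𝓝 0) := by
  have hp' : p ≠ ⊤ := by rcases hp with rfl | rfl <;> simp
  have hq' : q ≠ ⊤ := by rcases hq with rfl | rfl <;> simp
  refine ⟨RobustSignature.integrable_robustSig hp' hq', fun μs μ => ?_⟩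
  simp only [RobustSignature.d0]
  rw [← tendsto_iff_norm_sub_tendsto_zero]
  exact ⟨RobustSignature.tendsto_expectedRobustSig hp' hq', fun h =>
    RobustSignature.tendsto_of_tendsto_integral_robustCoeff hp'
      (RobustSignature.tendsto_integral_robustCoeff hp' hq' h)⟩
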